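/- Let $R=(r_1,\ldots,r_m)\in\mathbb Z_{>0}^m$, $C=(c_1,\ldots,c_n)\in\mathbb Z_{>0}^n$ and $K=(k_{ij})\in\mathbb Z_{>0}^{m\times n}$. Let $T_K(R,C)$ denote the number of $m\times n$ matrices with nonnegative integer entries $a_{ij}\le k_{ij}$, row sums $r_1,\ldots,r_m$ and column sums $c_1,\ldots,c_n$, and assume that $T_K(R,C)>0$. For $s\ge 1$ let $R^{(s)}\in\mathbb Z_{>0}^{sm}$ be the vector $(sr_1,\ldots,sr_m)$ repeated $s$ times, let $C^{(s)}\in\mathbb Z_{>0}^{sn}$ be the vector $(sc_1,\ldots,sc_n)$ repeated $s$ times, and let $K^{(s)}$ be the $sm\times sn$ matrix consisting of $s\times s$ blocks, each equal to $K$. Put $$G(\mathbf x,\mathbf y)=\prod_{i=1}^m\prod_{j=1}^n\left[1+x_iy_j+(x_iy_j)^2+\cdots+(x_iy_j)^{k_{ij}}\right],\qquad \mathbf x^R=\prod_{i=1}^m x_i^{r_i},\qquad \mathbf y^C=\prod_{j=1}^n y_j^{c_j}.$$ Then $T_{K^{(s)}}(R^{(s)},C^{(s)})>0$ for all $s$,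 the infimum of $G(\mathbf x,\mathbf y)/(\mathbf x^R\mathbf y^C)$ over all $x_1,\ldots,x_m,y_1,\ldots,y_n>0$ is positive, and $$\lim_{s\to\infty}\frac1{s^2}\ln T_{K^{(s)}}(R^{(s)},C^{(s)})=\ln\left(\inf_{x_1,\ldots,x_m,y_1,\ldots,y_n>0}\frac{G(\mathbf x,\mathbf y)}{\mathbf x^R\mathbf y^C}\right).$$ Moreover, as $s\to\infty$ with $R$, $C$, $K$ fixed, $$\frac1{s^2}\ln T_{K^{(s)}}(R^{(s)},C^{(s)})=\ln\left(\inf_{x_1,\ldots,x_m,y_1,\ldots,y_n>0}\frac{G(\mathbf x,\mathbf y)}{\mathbf x^R\mathbf y^C}\right)+O\left(\frac{\ln s}{s}\right).$$ -/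

import Mathlib

open Filter Topology Asymptotics

/-- The set of contingency tables (matrices of nonnegative integers) with row sums `R` and
column sums `C`, bounded entrywise by `K`. -/
def boundedTables {ι κ : Type*} [Fintype ι] [Fintype κ]
    (K : Matrix ι κ ℕ) (R : ι → ℕ) (C : κ → ℕ) : Set (Matrix ι κ ℕ) :=
  {A | (∀ i, ∑ j, A i j = R i) ∧ (∀ j, ∑ i, A i j = C j) ∧ ∀ i j, A i j ≤ K i j}

/-- `T_K(R, C)`, the number of `K`-bounded contingency tables with margins `R`, `C`.
The set counted is finite, being bounded entrywise. -/
noncomputable def tableCount {ι κ : Type*} [Fintype ι] [Fintype κ]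
    (K : Matrix ι κ ℕ) (R : ι → ℕ) (C : κ → ℕ) : ℕ :=
  (boundedTables K R C).ncard

/-- The `s`-fold cloning `(sR, sR, …, sR)` of a margin `R`, with `s` repetitions;
`Fin.modNat` sends a position to its position inside its block. -/
def cloneMargin {m : ℕ} (s : ℕ) (R : Fin m → ℕ) : Fin (s * m) → ℕ :=
  fun a => s * R a.modNat

/-- The `s`-fold cloning of a matrix: `s × s` blocks, each equal to `K`. -/
def cloneMatrix {m n : ℕ} (s : ℕ) (K : Matrix (Fin m) (Fin n) ℕ) :
    Matrix (Fin (s * m)) (Fin (s * n)) ℕ :=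
  fun a b => K a.modNat b.modNat

/-- `G(x, y) = ∏ᵢ ∏ⱼ (1 + xᵢyⱼ + (xᵢyⱼ)² + ⋯ + (xᵢyⱼ)^{kᵢⱼ})`. -/
noncomputable def tableGenFun {ι κ : Type*} [Fintype ι] [Fintype κ]
    (K : Matrix ι κ ℕ) (x : ι → ℝ) (y : κ → ℝ) : ℝ :=
  ∏ i, ∏ j, ∑ t ∈ Finset.range (K i j + 1), (x i * y j) ^ t

/-- The infimum of `G(x, y) / (x^R y^C)` over all `x, y` with positive coordinates
(a nonempty set of values, bounded below by `0`). -/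
noncomputable def genFunInf {ι κ : Type*} [Fintype ι] [Fintype κ]
    (K : Matrix ι κ ℕ) (R : ι → ℕ) (C : κ → ℕ) : ℝ :=
  sInf {v : ℝ | ∃ (x : ι → ℝ) (y : κ → ℝ), (∀ i, 0 < x i) ∧ (∀ j, 0 < y j) ∧
    v = tableGenFun K x y / ((∏ i, x i ^ R i) * ∏ j, y j ^ C j)}

/-! Write g for the infimum. The count is the coefficient of x^R y^C in G, a polynomial with
nonnegative coefficients, so it is at most every value of G / (x^R y^C). At cloned variables this
quotient is raised to the power s², whence ln T ≤ s² ln g.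

For the lower bound, cut an sm × sn matrix into s² blocks and read it as a word of length s² over
the finite alphabet of K-bounded m × n matrices. After x = exp u, y = exp u', the quotient becomes
the partition function of the vectors `marginDefect`. Entropy duality gives a mean-zero distribution
of entropy at least ln g, and the method of types turns it into exp(s² ln g - O(ln s)) words of
total defect zero (`log_ncard_sum_eq_zero_ge`).

Such a word has the right margins only after summing over clones. However, only exp(O(s ln s))
margins can occur, and none of them admits more tables than the uniform one
(`tableCount_blockClone_le_uniform`), so the loss is a factor exp(O(s ln s)) (`ncard_words_le`).
Maximality of the uniform margin holds because levelling two columns with equal bounds does not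
decrease the count: the distribution of the sum of one column, given the row sums of the pair, is a
convolution of intervals, hence symmetric and unimodal. -/

/-! ### Symmetric unimodality of convolutions of intervals. -/

/-- `N : ℤ → ℕ` is symmetric about `U / 2` and nonincreasing to the right of `U / 2`. -/
structure SymmUnimodal (U : ℤ) (N : ℤ → ℕ) : Prop where
  symm : ∀ c, N (U - c) = N c
  le_pred : ∀ c, U < 2 * c → N c ≤ N (c - 1)

lemma SymmUnimodal.antitone_right {U : ℤ} {N : ℤ → ℕ} (h : SymmUnimodal U N) (k : ℕ) :
    ∀ x : ℤ, U ≤ 2 * x → N (x + k) ≤ N x := by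
  induction k with
  | zero => intro x _; simp
  | succ k ih =>
    intro x hx
    have h1 := h.le_pred (x + (k + 1 : ℕ)) (by push_cast; omega)
    have h2 : x + ((k + 1 : ℕ) : ℤ) - 1 = x + k := by push_cast; ring
    rw [h2] at h1
    exact h1.trans (ih x hx)

/-- The hypotheses say that `x` is at least as close to the centre `U / 2` as `y`; reflect `x` if it
lies left of the centre. -/
lemma SymmUnimodal.le_of_closer {U : ℤ} {N : ℤ → ℕ} (h : SymmUnimodal U N) {x y : ℤ}
    (h1 : x ≤ y) (h2 : U ≤ x + y) : N y ≤ N x := by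
  rcases le_total U (2 * x) with hx | hx
  · obtain ⟨k, hk⟩ := Int.le.dest h1
    rw [← hk]; exact h.antitone_right k x hx
  · rw [← h.symm x]
    obtain ⟨k, hk⟩ := Int.le.dest (show U - x ≤ y by omega)
    rw [← hk]; exact h.antitone_right k _ (by omega)

lemma sum_Icc_reflect (N : ℤ → ℕ) (l h c : ℤ) :
    ∑ t ∈ Finset.Icc l h, N (c + t) = ∑ t ∈ Finset.Icc l h, N (c + (l + h) - t) := by
  refine Finset.sum_nbij' (fun t => l + h - t) (fun t => l + h - t) ?_ ?_ ?_ ?_ ?_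
  · intro t ht; simp only [Finset.mem_Icc] at *; omega
  · intro t ht; simp only [Finset.mem_Icc] at *; omega
  · intro t _; ring
  · intro t _; ring
  · intro t _; congr 1; ring

/-- The window sums at `c` and `c - 1` differ only in their end terms `N (c - l)` and `N (c - 1 -
h)`, and the latter argument is closer to the centre. -/
lemma SymmUnimodal.conv_interval {U : ℤ} {N : ℤ → ℕ} (hN : SymmUnimodal U N) {l h : ℤ}
    (hlh : l ≤ h) :
    SymmUnimodal (U + (l + h)) (fun c => ∑ t ∈ Finset.Icc l h, N (c - t)) where
  symm c := by
    have h1 : ∀ t, N (U + (l + h) - c - t) = N ((c - (l + h)) + t) := by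
      intro t
      rw [← hN.symm]; congr 1; ring
    simp only [h1]
    rw [sum_Icc_reflect]
    refine Finset.sum_congr rfl fun t _ => ?_
    congr 1; ring
  le_pred c hc := by
    have e1 : ∑ t ∈ Finset.Icc l h, N (c - t) = N (c - l) + ∑ t ∈ Finset.Ioc l h, N (c - t) := by
      rw [← Finset.Ioc_insert_left hlh, Finset.sum_insert (by simp)]
    have e2 : ∑ t ∈ Finset.Icc l h, N (c - 1 - t)
        = N (c - 1 - h) + ∑ t ∈ Finset.Ico l h, N (c - 1 - t) := by
      rw [← Finset.Ico_insert_right hlh, Finset.sum_insert (by simp)]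
    have e3 : ∑ t ∈ Finset.Ico l h, N (c - 1 - t) = ∑ t ∈ Finset.Ioc l h, N (c - t) := by
      refine Finset.sum_nbij' (fun t => t + 1) (fun t => t - 1) ?_ ?_ ?_ ?_ ?_
      · intro t ht; simp only [Finset.mem_Ico, Finset.mem_Ioc] at *; omega
      · intro t ht; simp only [Finset.mem_Ico, Finset.mem_Ioc] at *; omega
      · intro t _; ring
      · intro t _; ring
      · intro t _; congr 1; ring
    have := hN.le_of_closer (x := c - 1 - h) (y := c - l) (by omega) (by omega)
    simp only [e1, e2, e3]
    omega

open AddMonoidAlgebra in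
lemma coeff_prod_interval_symmUnimodal {ι : Type*} (l h : ι → ℤ) (s : Finset ι)
    (hlh : ∀ i ∈ s, l i ≤ h i) :
    SymmUnimodal (∑ i ∈ s, (l i + h i))
      (fun c => (∏ i ∈ s, ∑ t ∈ Finset.Icc (l i) (h i),
        (single t 1 : AddMonoidAlgebra ℕ ℤ)).coeff c) := by
  classical
  induction s using Finset.induction_on with
  | empty =>
    have h1 : ∀ c : ℤ, (1 : AddMonoidAlgebra ℕ ℤ).coeff c = if 0 = c then 1 else 0 := by
      intro c
      rw [AddMonoidAlgebra.one_def, AddMonoidAlgebra.coeff_single, Finsupp.single_apply]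
    simp only [Finset.sum_empty, Finset.prod_empty, h1]
    constructor
    · intro c
      congr 1
      rw [zero_sub, zero_eq_neg, eq_comm (a := c)]
    · intro c hc
      rw [if_neg (by omega)]
      exact Nat.zero_le _
  | insert a s ha ih =>
    rw [Finset.sum_insert ha, add_comm]
    have := (ih fun i hi => hlh i (Finset.mem_insert_of_mem hi)).conv_interval
      (hlh a (Finset.mem_insert_self a s))
    convert this using 2 with c
    rw [Finset.prod_insert ha, Finset.sum_mul, AddMonoidAlgebra.coeff_sum,
      Finsupp.finsetSum_apply]
    refine Finset.sum_congr rfl fun t _ => ?_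
    rw [AddMonoidAlgebra.coeff_single_mul_eq_mul_coeff (c - t) fun m _ => by omega, one_mul]

open AddMonoidAlgebra in
lemma coeff_prod_interval_eq_card {ι : Type*} [Fintype ι] [DecidableEq ι] (l h : ι → ℤ) (c : ℤ) :
    (∏ i, ∑ t ∈ Finset.Icc (l i) (h i), (single t 1 : AddMonoidAlgebra ℕ ℤ)).coeff c
      = ((Fintype.piFinset fun i => Finset.Icc (l i) (h i)).filter
          fun a => ∑ i, a i = c).card := by
  have hp : ∀ (s : Finset ι) (a : ι → ℤ), ∏ i ∈ s, (single (a i) 1 : AddMonoidAlgebra ℕ ℤ)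
      = single (∑ i ∈ s, a i) 1 := by
    intro s a
    induction s using Finset.induction_on with
    | empty => rw [Finset.prod_empty, Finset.sum_empty, AddMonoidAlgebra.one_def]
    | insert b s hb ih =>
      rw [Finset.prod_insert hb, Finset.sum_insert hb, ih, AddMonoidAlgebra.single_mul_single,
        one_mul]
  rw [Finset.prod_univ_sum, AddMonoidAlgebra.coeff_sum, Finsupp.finsetSum_apply,
    Finset.card_filter]
  refine Finset.sum_congr rfl fun a _ => ?_
  rw [hp, AddMonoidAlgebra.coeff_single, Finsupp.single_apply]

/-- Among the ways to split `u` into two vectors bounded by `k`, those with first part of sum `c`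
are at most as many as those with first part of sum `c - 1`, if `c` is past the middle. -/
lemma card_splits_le {ι : Type*} [Fintype ι] [DecidableEq ι] (k u : ι → ℤ) (c : ℤ)
    (hc : ∑ i, u i < 2 * c) :
    ((Fintype.piFinset fun i => Finset.Icc (max 0 (u i - k i)) (min (k i) (u i))).filter
          fun a => ∑ i, a i = c).card ≤
    ((Fintype.piFinset fun i => Finset.Icc (max 0 (u i - k i)) (min (k i) (u i))).filter
          fun a => ∑ i, a i = c - 1).card := by
  by_cases hlh : ∀ i, max 0 (u i - k i) ≤ min (k i) (u i)
  · rw [← coeff_prod_interval_eq_card, ← coeff_prod_interval_eq_card]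
    have h := coeff_prod_interval_symmUnimodal (fun i => max 0 (u i - k i))
      (fun i => min (k i) (u i)) Finset.univ (fun i _ => hlh i)
    refine h.le_pred c ?_
    -- Each interval is symmetric under `a ↦ u i - a`, so its endpoints add up to `u i`.
    have : ∑ i, (max 0 (u i - k i) + min (k i) (u i)) = ∑ i, u i :=
      Finset.sum_congr rfl fun i _ => by omega
    rwa [this]
  · push Not at hlh
    obtain ⟨i, hi⟩ := hlh
    rw [Finset.card_eq_zero.2]
    · exact Nat.zero_le _
    · rw [Finset.filter_eq_empty_iff]
      intro a ha
      have := Fintype.mem_piFinset.1 ha i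
      rw [Finset.mem_Icc] at this
      omega

/-! ### Levelling margins does not decrease the number of tables. -/

lemma boundedTables_finite {ι κ : Type*} [Fintype ι] [Fintype κ]
    (K : Matrix ι κ ℕ) (R : ι → ℕ) (C : κ → ℕ) : (boundedTables K R C).Finite := by
  classical
  let k : ι → κ → ℕ := K
  have h : {A : ι → κ → ℕ | A ≤ k}.Finite := Set.finite_Iic k
  exact h.subset fun A hA i j => hA.2.2 i j

lemma tableCount_transpose {ι κ : Type*} [Fintype ι] [Fintype κ]
    (K : Matrix ι κ ℕ) (R : ι → ℕ) (C : κ → ℕ) :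
    tableCount K.transpose C R = tableCount K R C := by
  unfold tableCount
  refine Set.ncard_congr (fun A _ => A.transpose) ?_ ?_ ?_
  · rintro A ⟨h1, h2, h3⟩
    exact ⟨h2, h1, fun i j => h3 j i⟩
  · intro A B _ _ h
    exact Matrix.transpose_injective h
  · rintro A ⟨h1, h2, h3⟩
    exact ⟨A.transpose, ⟨h2, h1, fun i j => h3 j i⟩, rfl⟩

/-- Moving one unit from a column to a smaller one with the same entrywise bounds does not decrease
the number of tables. -/
lemma tableCount_le_transfer {ι κ : Type*} [Fintype ι] [Fintype κ] [DecidableEq κ]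
    (K : Matrix ι κ ℕ) (R : ι → ℕ) (C : κ → ℕ) (j₁ j₂ : κ) (hK : ∀ i, K i j₁ = K i j₂)
    (hC : C j₂ < C j₁) :
    tableCount K R C ≤
      tableCount K R (Function.update (Function.update C j₁ (C j₁ - 1)) j₂ (C j₂ + 1)) := by
  classical
  have hne : j₁ ≠ j₂ := by rintro rfl; exact lt_irrefl _ hC
  set S : (ι → ℤ) → ℤ → Finset (ι → ℤ) := fun u c =>
    (Fintype.piFinset fun i => Finset.Icc (max 0 (u i - K i j₁)) (min (K i j₁ : ℤ) (u i))).filter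
          fun a => ∑ i, a i = c with hS
  -- The injection depends only on the sum `u` of the two columns. The transfer preserves `u`, so
  -- the image of a table determines which injection was applied.
  have hinj : ∀ u : ι → ℤ, ∃ ψ : (ι → ℤ) → (ι → ℤ), ∑ i, u i = C j₁ + C j₂ →
      Set.InjOn ψ (S u (C j₁)) ∧ Set.MapsTo ψ (S u (C j₁)) (S u (C j₁ - 1)) := by
    intro u
    by_cases hu : ∑ i, u i = C j₁ + C j₂
    · have h := card_splits_le (fun i => (K i j₁ : ℤ)) u (C j₁) (by omega)
      obtain ⟨e⟩ : Nonempty (S u (C j₁) ↪ S u (C j₁ - 1)) :=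
        Function.Embedding.nonempty_of_card_le (by simpa only [Fintype.card_coe] using h)
      refine ⟨fun x => if hx : x ∈ S u (C j₁) then e ⟨x, hx⟩ else x, fun _ => ⟨?_, ?_⟩⟩
      · intro x hx y hy hxy
        simp only [Finset.mem_coe] at hx hy
        simp only [dif_pos hx, dif_pos hy] at hxy
        exact congrArg Subtype.val (e.injective (Subtype.ext hxy))
      · intro x hx
        simp only [Finset.mem_coe] at hx
        simp only [dif_pos hx]
        exact (e ⟨x, hx⟩).2
    · exact ⟨id, fun h => absurd h hu⟩
  choose ψ hψ using hinj
  set u : Matrix ι κ ℕ → ι → ℤ := fun A i => A i j₁ + A i j₂ with hu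
  set col : Matrix ι κ ℕ → ι → ℤ := fun A i => A i j₁ with hcol
  have hmem : ∀ A ∈ boundedTables K R C, ∑ i, u A i = C j₁ + C j₂ ∧ col A ∈ S (u A) (C j₁) := by
    rintro A ⟨h1, h2, h3⟩
    refine ⟨?_, ?_⟩
    · simp only [hu, Finset.sum_add_distrib]
      rw [← h2 j₁, ← h2 j₂]; push_cast; rfl
    · simp only [hS, Finset.mem_filter, Fintype.mem_piFinset, Finset.mem_Icc]
      refine ⟨fun i => ?_, ?_⟩
      · have e1 := h3 i j₁
        have e2 := h3 i j₂
        have e3 := hK i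
        simp only [hu, hcol]
        omega
      · rw [← h2 j₁]; push_cast; rfl
  set Φ : Matrix ι κ ℕ → Matrix ι κ ℕ := fun A i j =>
    if j = j₁ then (ψ (u A) (col A) i).toNat
    else if j = j₂ then (u A i - ψ (u A) (col A) i).toNat else A i j with hΦ
  have hrange : ∀ A ∈ boundedTables K R C, (∀ i, 0 ≤ ψ (u A) (col A) i ∧
      ψ (u A) (col A) i ≤ K i j₁ ∧ ψ (u A) (col A) i ≤ u A i ∧
      u A i ≤ ψ (u A) (col A) i + K i j₁) ∧ ∑ i, ψ (u A) (col A) i = C j₁ - 1 := by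
    intro A hA
    have h := (hψ (u A) (hmem A hA).1).2 (hmem A hA).2
    simp only [hS, Finset.coe_filter, Set.mem_ofPred_eq, Fintype.mem_piFinset, Finset.mem_Icc] at h
    refine ⟨fun i => ?_, h.2⟩
    have := h.1 i
    omega
  have hval : ∀ A ∈ boundedTables K R C, ∀ i, (Φ A i j₁ : ℤ) = ψ (u A) (col A) i ∧
      (Φ A i j₂ : ℤ) = u A i - ψ (u A) (col A) i ∧ ∀ j, j ≠ j₁ → j ≠ j₂ → Φ A i j = A i j := by
    intro A hA i
    have := (hrange A hA).1 i
    refine ⟨?_, ?_, ?_⟩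
    · simp only [hΦ, if_true]; omega
    · simp only [hΦ, if_neg hne.symm, if_true]; omega
    · intro j hj1 hj2
      simp only [hΦ, if_neg hj1, if_neg hj2]
  have hsplit : ∀ f : κ → ℕ, ∑ j, f j = f j₁ + f j₂ + ∑ j ∈ (Finset.univ.erase j₁).erase j₂, f j := by
    intro f
    rw [← Finset.add_sum_erase _ f (Finset.mem_univ j₁),
      ← Finset.add_sum_erase _ f (Finset.mem_erase.2 ⟨hne.symm, Finset.mem_univ j₂⟩), add_assoc]
  refine Set.ncard_le_ncard_of_injOn Φ ?_ ?_ (boundedTables_finite _ _ _)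
  · intro A hA
    have hA' := hA
    obtain ⟨h1, h2, h3⟩ := hA'
    refine ⟨fun i => ?_, fun j => ?_, fun i j => ?_⟩
    · rw [← h1 i, hsplit, hsplit (A i)]
      congr 1
      · have := hval A hA i
        simp only [hu] at this
        omega
      · refine Finset.sum_congr rfl fun j hj => (hval A hA i).2.2 j ?_ ?_
        · simp only [Finset.mem_erase] at hj; exact hj.2.1
        · simp only [Finset.mem_erase] at hj; exact hj.1
    · have hs := (hrange A hA).2
      by_cases hj2 : j = j₂
      · subst hj2
        rw [Function.update_self]
        zify
        rw [Finset.sum_congr rfl fun i _ => (hval A hA i).2.1, Finset.sum_sub_distrib, hs,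
          (hmem A hA).1]
        ring
      · rw [Function.update_of_ne hj2]
        by_cases hj1 : j = j₁
        · subst hj1
          rw [Function.update_self]
          zify
          rw [Finset.sum_congr rfl fun i _ => (hval A hA i).1, hs]
          omega
        · rw [Function.update_of_ne hj1, ← h2 j]
          exact Finset.sum_congr rfl fun i _ => (hval A hA i).2.2 j hj1 hj2
    · have hv := hval A hA i
      have hr := (hrange A hA).1 i
      by_cases hj1 : j = j₁
      · subst hj1; omega
      · by_cases hj2 : j = j₂
        · subst hj2; have := hK i; omega
        · rw [hv.2.2 j hj1 hj2]; exact h3 i j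
  · intro A hA B hB hAB
    have huAB : u A = u B := by
      funext i
      have e1 := hval A hA i
      have e2 := hval B hB i
      rw [hAB] at e1
      omega
    have hψAB : ψ (u A) (col A) = ψ (u A) (col B) := by
      funext i
      have e1 := hval A hA i
      have e2 := hval B hB i
      rw [hAB] at e1
      rw [← huAB] at e2
      omega
    have hcolAB : col A = col B :=
      (hψ (u A) (hmem A hA).1).1 (hmem A hA).2 (by rw [huAB]; exact (hmem B hB).2) hψAB
    funext i j
    have c1 := congrFun hcolAB i
    have c2 := congrFun huAB i
    simp only [hu, hcol] at c1 c2
    by_cases hj1 : j = j₁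
    · subst hj1; omega
    · by_cases hj2 : j = j₂
      · subst hj2; omega
      · rw [← (hval A hA i).2.2 j hj1 hj2, ← (hval B hB i).2.2 j hj1 hj2, hAB]

/-- If `K` has equal columns within each fibre of `g`, then among the column margins with
prescribed sums over the fibres, one that is constant on fibres maximizes the number of tables. -/
lemma tableCount_le_of_fiber_const {ι κ γ : Type*} [Fintype ι] [Fintype κ] [DecidableEq γ]
    (g : κ → γ) (K : Matrix ι κ ℕ) (R : ι → ℕ)
    (hK : ∀ j₁ j₂, g j₁ = g j₂ → ∀ i, K i j₁ = K i j₂)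
    (D : κ → ℕ) (hD : ∀ j₁ j₂, g j₁ = g j₂ → D j₁ = D j₂) (N : ℕ) :
    ∀ C : κ → ℕ, ∑ j, (C j - D j) = N →
      (∀ q, ∑ j with g j = q, C j = ∑ j with g j = q, D j) →
      tableCount K R C ≤ tableCount K R D := by
  classical
  -- The truncated differences record only the columns above `D`, so `N` is the total excess; a
  -- transfer from a column above `D` to one below it lowers `N` by one.
  induction N using Nat.strong_induction_on with
  | _ N ih =>
  intro C hN hsum
  by_cases hCD : C = D
  · rw [hCD]
  obtain ⟨j, hj⟩ := Function.ne_iff.1 hCD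
  have hmem : j ∈ Finset.univ.filter (fun j' => g j' = g j) := by simp
  have hlt : ∃ j₁, g j₁ = g j ∧ D j₁ < C j₁ := by
    by_contra! hcon
    exact hj ((Finset.sum_eq_sum_iff_of_le (s := Finset.univ.filter (fun j' => g j' = g j))
      (fun i hi => hcon i (Finset.mem_filter.1 hi).2)).1 (hsum (g j)) j hmem)
  have hgt : ∃ j₂, g j₂ = g j ∧ C j₂ < D j₂ := by
    by_contra! hcon
    exact hj ((Finset.sum_eq_sum_iff_of_le (s := Finset.univ.filter (fun j' => g j' = g j))
      (fun i hi => hcon i (Finset.mem_filter.1 hi).2)).1 (hsum (g j)).symm j hmem).symm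
  obtain ⟨j₁, hg1, h1⟩ := hlt
  obtain ⟨j₂, hg2, h2⟩ := hgt
  have hg : g j₁ = g j₂ := hg1.trans hg2.symm
  have hDD := hD j₁ j₂ hg
  have hne : j₁ ≠ j₂ := by rintro rfl; omega
  refine (tableCount_le_transfer K R C j₁ j₂ (hK j₁ j₂ hg) (by omega)).trans ?_
  set C' := Function.update (Function.update C j₁ (C j₁ - 1)) j₂ (C j₂ + 1) with hC'
  have v2 : C' j₂ = C j₂ + 1 := by simp [hC']
  have v1 : C' j₁ = C j₁ - 1 := by simp [hC', Function.update_of_ne hne]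
  have v0 : ∀ j', j' ≠ j₁ → j' ≠ j₂ → C' j' = C j' := by
    intro j' a b
    simp [hC', Function.update_of_ne a, Function.update_of_ne b]
  refine ih _ ?_ C' rfl ?_
  · rw [← hN]
    refine Finset.sum_lt_sum (fun j' _ => ?_) ⟨j₁, Finset.mem_univ _, by omega⟩
    by_cases a : j' = j₁
    · subst a; omega
    · by_cases b : j' = j₂
      · subst b; omega
      · rw [v0 j' a b]
  · intro q
    rw [← hsum q]
    by_cases hq : g j₁ = q
    · have m1 : j₁ ∈ Finset.univ.filter (fun j' => g j' = q) := by simp [hq]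
      have m2 : j₂ ∈ (Finset.univ.filter (fun j' => g j' = q)).erase j₁ := by
        simp [← hg, hq, hne.symm]
      rw [← Finset.add_sum_erase _ C' m1, ← Finset.add_sum_erase _ C' m2,
        ← Finset.add_sum_erase _ C m1, ← Finset.add_sum_erase _ C m2, v1, v2]
      have hrest : ∑ j' ∈ ((Finset.univ.filter (fun j' => g j' = q)).erase j₁).erase j₂, C' j'
          = ∑ j' ∈ ((Finset.univ.filter (fun j' => g j' = q)).erase j₁).erase j₂, C j' := by
        refine Finset.sum_congr rfl fun j' hj' => v0 j' ?_ ?_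
        · simp only [Finset.mem_erase] at hj'; exact hj'.2.1
        · simp only [Finset.mem_erase] at hj'; exact hj'.1
      rw [hrest]
      omega
    · refine Finset.sum_congr rfl fun j' hj' => v0 j' ?_ ?_
      · rintro rfl; exact hq (Finset.mem_filter.1 hj').2
      · rintro rfl; exact hq (hg.trans (Finset.mem_filter.1 hj').2)

/-! ### Entropy duality. -/

/-- A log-partition function need not attain its infimum; the quadratic term makes it coercive. -/
lemma exists_regularized_min {d : Type*} [Fintype d] (f : (d → ℝ) → ℝ) (hf : Continuous f)
    (hpos : ∀ u, 0 ≤ f u) {δ : ℝ} (hδ : 0 < δ) :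
    ∃ u, ∀ w, f u + δ * ∑ i, u i ^ 2 ≤ f w + δ * ∑ i, w i ^ 2 := by
  refine Continuous.exists_forall_le' (f := fun u : d → ℝ => f u + δ * ∑ i, u i ^ 2)
    (by fun_prop) 0 ?_
  filter_upwards [(tendsto_norm_cocompact_atTop (E := d → ℝ)).eventually_ge_atTop
    (max 1 (f 0 / δ))] with u hu
  have h1 : 1 ≤ ‖u‖ := (le_max_left _ _).trans hu
  have h2 : f 0 / δ ≤ ‖u‖ := (le_max_right _ _).trans hu
  have h3 : ‖u‖ ^ 2 ≤ ∑ i, u i ^ 2 := by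
    have hn : ‖u‖ ≤ √(∑ i, u i ^ 2) := by
      refine (pi_norm_le_iff_of_nonneg (Real.sqrt_nonneg _)).2 fun i => ?_
      rw [Real.norm_eq_abs]
      refine Real.abs_le_sqrt ?_
      exact Finset.single_le_sum (f := fun i => u i ^ 2) (fun i _ => sq_nonneg _)
        (Finset.mem_univ i)
    calc ‖u‖ ^ 2 ≤ √(∑ i, u i ^ 2) ^ 2 := by gcongr
      _ = _ := Real.sq_sqrt (Finset.sum_nonneg fun i _ => sq_nonneg _)
  have h4 : f 0 ≤ δ * ∑ i, u i ^ 2 := by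
    rw [div_le_iff₀ hδ] at h2
    have h5 : ‖u‖ ≤ ∑ i, u i ^ 2 := by nlinarith
    calc f 0 ≤ δ * ‖u‖ := by linarith
      _ ≤ _ := by gcongr
  have := hpos u
  simp only [Pi.zero_apply, ne_eq, OfNat.ofNat_ne_zero, not_false_eq_true, zero_pow,
    Finset.sum_const_zero, mul_zero, add_zero]
  linarith

lemma stationary_of_regularized_min {A d : Type*} [Fintype A] [Nonempty A] [Fintype d]
    (v : A → d → ℝ) {δ : ℝ} (u : d → ℝ)
    (hu : ∀ w : d → ℝ, Real.log (∑ a, Real.exp (∑ i, u i * v a i)) + δ * ∑ i, u i ^ 2 ≤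
      Real.log (∑ a, Real.exp (∑ i, w i * v a i)) + δ * ∑ i, w i ^ 2) (i : d) :
    (∑ a, Real.exp (∑ i, u i * v a i) * v a i) / (∑ a, Real.exp (∑ i, u i * v a i))
      = -(2 * δ * u i) := by
  classical
  have hZ : 0 < ∑ a, Real.exp (∑ i, u i * v a i) :=
    Finset.sum_pos (fun a _ => Real.exp_pos _) Finset.univ_nonempty
  set h : ℝ → ℝ := fun t => Real.log (∑ a, Real.exp (∑ i, u i * v a i + t * v a i))
    + δ * (∑ i, u i ^ 2 + 2 * t * u i + t ^ 2) with hh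
  have hline : ∀ t : ℝ, h t = Real.log (∑ a, Real.exp (∑ j, (u + t • Pi.single i (1 : ℝ) : d → ℝ) j * v a j))
      + δ * ∑ j, (u + t • Pi.single i (1 : ℝ) : d → ℝ) j ^ 2 := by
    intro t
    have e1 : ∀ a, ∑ j, (u + t • Pi.single i (1 : ℝ) : d → ℝ) j * v a j
        = ∑ j, u j * v a j + t * v a i := by
      intro a
      simp [add_mul, Finset.sum_add_distrib, Pi.single_apply]
    have e2 : ∑ j, (u + t • Pi.single i (1 : ℝ) : d → ℝ) j ^ 2 = ∑ j, u j ^ 2 + 2 * t * u i + t ^ 2 := by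
      have : ∀ j, (u + t • Pi.single i (1 : ℝ) : d → ℝ) j ^ 2
          = u j ^ 2 + (if j = i then 2 * t * u i + t ^ 2 else 0) := by
        intro j
        by_cases hj : j = i
        · subst hj; simp; ring
        · simp [hj]
      simp only [this, Finset.sum_add_distrib, Finset.sum_ite_eq', Finset.mem_univ, if_true]
      ring
    simp only [e1, e2, hh]
  have hmin : IsLocalMin h 0 := by
    have h0 : h 0 = Real.log (∑ a, Real.exp (∑ i, u i * v a i)) + δ * ∑ i, u i ^ 2 := by
      simp [hh]
    refine Filter.Eventually.of_forall fun t => ?_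
    rw [h0, hline]
    exact hu _
  have hder : HasDerivAt h ((∑ a, Real.exp (∑ i, u i * v a i) * v a i) /
      (∑ a, Real.exp (∑ i, u i * v a i)) + δ * (2 * u i)) 0 := by
    have d1 : HasDerivAt (fun t : ℝ => ∑ a, Real.exp (∑ i, u i * v a i + t * v a i))
        (∑ a, Real.exp (∑ i, u i * v a i) * v a i) 0 := by
      refine HasDerivAt.fun_sum fun a _ => ?_
      have := (((hasDerivAt_id (0 : ℝ)).mul_const (v a i)).const_add (∑ i, u i * v a i)).exp
      simpa using this
    have d2 := d1.log (by simpa using hZ.ne')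
    have d3 : HasDerivAt (fun t : ℝ => δ * (∑ i, u i ^ 2 + 2 * t * u i + t ^ 2)) (δ * (2 * u i)) 0 := by
      have := (((((hasDerivAt_id (0 : ℝ)).const_mul 2).mul_const (u i)).const_add
        (∑ i, u i ^ 2)).add ((hasDerivAt_id (0 : ℝ)).pow 2)).const_mul δ
      simpa using this
    have d4 := d2.add d3
    simp only [zero_mul, add_zero] at d4
    exact d4
  have := hmin.hasDerivAt_eq_zero hder
  linarith

/-- At the regularized minimizer `u`, the Gibbs distribution `p a ∝ exp (u · v a)` has mean `-2δu`
and entropy `log Z + 2δ|u|²`, which is at least `L`. -/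
lemma exists_near_maxEntropy {A d : Type*} [Fintype A] [Fintype d] (v : A → d → ℝ) (L : ℝ)
    (a₀ : A) (ha₀ : v a₀ = 0)
    (hL : ∀ u : d → ℝ, L ≤ Real.log (∑ a, Real.exp (∑ i, u i * v a i))) {δ : ℝ} (hδ : 0 < δ) :
    ∃ p ∈ stdSimplex ℝ A, L ≤ ∑ a, Real.negMulLog (p a) ∧
      ∑ i, (∑ a, p a * v a i) ^ 2 ≤ 4 * δ * Real.log (Fintype.card A) := by
  have : Nonempty A := ⟨a₀⟩
  have hZpos : ∀ u : d → ℝ, 0 < ∑ a, Real.exp (∑ i, u i * v a i) := fun u =>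
    Finset.sum_pos (fun a _ => Real.exp_pos _) Finset.univ_nonempty
  have hZ1 : ∀ u : d → ℝ, 1 ≤ ∑ a, Real.exp (∑ i, u i * v a i) := by
    intro u
    have := Finset.single_le_sum (f := fun a => Real.exp (∑ i, u i * v a i))
      (fun a _ => (Real.exp_pos _).le) (Finset.mem_univ a₀)
    simpa [ha₀] using this
  obtain ⟨u, hu⟩ := exists_regularized_min
    (fun u : d → ℝ => Real.log (∑ a, Real.exp (∑ i, u i * v a i)))
    (Continuous.log (by fun_prop) fun u => (hZpos u).ne') (fun u => Real.log_nonneg (hZ1 u)) hδ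
  have hst := stationary_of_regularized_min v u hu
  set Z := ∑ a, Real.exp (∑ i, u i * v a i) with hZ
  have hZ0 : 0 < Z := hZpos u
  set p : A → ℝ := fun a => Real.exp (∑ i, u i * v a i) / Z with hp
  have hE : ∀ i, ∑ a, p a * v a i = -(2 * δ * u i) := by
    intro i
    rw [← hst i, Finset.sum_div]
    exact Finset.sum_congr rfl fun a _ => by simp only [hp]; ring
  have hp1 : ∑ a, p a = 1 := by
    simp only [hp, ← Finset.sum_div]
    exact div_self hZ0.ne'
  -- Compare with the value at `0`, which is `log |A|`; the log-partition function is nonnegative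
  -- because `a₀` contributes the term `1`.
  have hB : δ * ∑ i, u i ^ 2 ≤ Real.log (Fintype.card A) := by
    have h0 := hu 0
    have h1 := Real.log_nonneg (hZ1 u)
    simp at h0
    linarith
  refine ⟨p, ⟨fun a => by positivity, hp1⟩, ?_, ?_⟩
  · have hent : ∑ a, Real.negMulLog (p a) = Real.log Z + 2 * δ * ∑ i, u i ^ 2 := by
      have h1 : ∀ a, Real.negMulLog (p a) = p a * Real.log Z - ∑ i, u i * (p a * v a i) := by
        intro a
        have : Real.log (p a) = ∑ i, u i * v a i - Real.log Z := by
          simp only [hp]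
          rw [Real.log_div (Real.exp_pos _).ne' hZ0.ne', Real.log_exp]
        rw [Real.negMulLog, this, neg_mul, mul_sub, Finset.mul_sum, neg_sub]
        congr 1
        exact Finset.sum_congr rfl fun i _ => by ring
      simp only [h1, Finset.sum_sub_distrib]
      rw [← Finset.sum_mul, hp1, Finset.sum_comm]
      simp only [← Finset.mul_sum, hE]
      rw [one_mul, sub_eq_add_neg, ← Finset.sum_neg_distrib, Finset.mul_sum]
      congr 1
      exact Finset.sum_congr rfl fun i _ => by ring
    rw [hent]
    have := hL u
    have h2 : 0 ≤ ∑ i, u i ^ 2 := Finset.sum_nonneg fun i _ => sq_nonneg _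
    nlinarith
  · simp only [hE]
    have : ∑ i, (-(2 * δ * u i)) ^ 2 = 4 * δ * (δ * ∑ i, u i ^ 2) := by
      simp only [Finset.mul_sum]
      exact Finset.sum_congr rfl fun i _ => by ring
    rw [this]
    gcongr

/-- Entropy duality: if the log-partition function of the vectors `v a` is bounded below by `L`,
some distribution with mean zero has entropy at least `L`. -/
lemma exists_maxEntropy {A d : Type*} [Fintype A] [Fintype d] (v : A → d → ℝ) (L : ℝ)
    (a₀ : A) (ha₀ : v a₀ = 0)
    (hL : ∀ u : d → ℝ, L ≤ Real.log (∑ a, Real.exp (∑ i, u i * v a i))) :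
    ∃ p ∈ stdSimplex ℝ A, L ≤ ∑ a, Real.negMulLog (p a) ∧ ∀ i, ∑ a, p a * v a i = 0 := by
  have hcpt : IsCompact (stdSimplex ℝ A ∩ {p | L ≤ ∑ a, Real.negMulLog (p a)}) := by
    refine (isCompact_stdSimplex ℝ A).inter_right (isClosed_le continuous_const ?_)
    exact continuous_finsetSum _ fun a _ =>
      Real.continuous_negMulLog.comp (continuous_apply a)
  obtain ⟨p₁, hp₁, hp₁', -⟩ := exists_near_maxEntropy v L a₀ ha₀ hL one_pos
  obtain ⟨p, ⟨hp, hpL⟩, hmin⟩ := hcpt.exists_isMinOn ⟨p₁, hp₁, hp₁'⟩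
    (f := fun p : A → ℝ => ∑ i, (∑ a, p a * v a i) ^ 2) (by fun_prop)
  -- On the compact set of distributions of entropy at least `L`, the squared mean attains its
  -- minimum, and the approximate solutions make it arbitrarily small.
  have hzero : ∑ i, (∑ a, p a * v a i) ^ 2 ≤ 0 := by
    refine le_of_forall_pos_le_add fun ε hε => ?_
    have hB : 0 ≤ Real.log (Fintype.card A) := Real.log_natCast_nonneg _
    obtain ⟨q, hq, hq', hqs⟩ := exists_near_maxEntropy v L a₀ ha₀ hL
      (δ := ε / (4 * (Real.log (Fintype.card A) + 1))) (by positivity)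
    refine ((hmin ⟨hq, hq'⟩).trans hqs).trans ?_
    rw [zero_add, ← mul_div_assoc, mul_div_mul_left _ _ (by norm_num : (4 : ℝ) ≠ 0), div_mul_eq_mul_div, div_le_iff₀ (by positivity)]
    nlinarith
  refine ⟨p, hp, hpL, fun i => ?_⟩
  have h := (Finset.sum_eq_zero_iff_of_nonneg (fun i _ => sq_nonneg _)).1
    (le_antisymm hzero (Finset.sum_nonneg fun i _ => sq_nonneg _)) i (Finset.mem_univ i)
  exact pow_eq_zero_iff two_ne_zero |>.1 h

/-! ### The method of types. -/

lemma log_factorial_le (n : ℕ) :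
    Real.log n.factorial ≤ n * Real.log n - n + Real.log (n + 1) + 1 := by
  rcases n with _ | n
  · simp
  have h := Stirling.log_stirlingSeq'_antitone (Nat.zero_le n)
  simp only [Function.comp_apply, Nat.succ_eq_add_one, Stirling.log_stirlingSeq_formula] at h
  have hn : (0 : ℝ) < ((n + 1 : ℕ) : ℝ) := by positivity
  rw [Real.log_mul (by norm_num) hn.ne', Real.log_div hn.ne' (Real.exp_pos 1).ne',
    Real.log_exp] at h
  simp at h
  have h1 : Real.log (n + 1 : ℝ) ≤ Real.log ((n : ℝ) + 1 + 1) :=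
    Real.log_le_log (by positivity) (by linarith)
  have h2 : 0 ≤ Real.log (n + 1 : ℝ) := Real.log_nonneg (by linarith [n.cast_nonneg (α := ℝ)])
  push_cast
  linarith

lemma le_log_factorial (n : ℕ) : n * Real.log n - n ≤ Real.log n.factorial := by
  rcases Nat.eq_zero_or_pos n with rfl | hn
  · simp
  have h := Real.pow_div_factorial_le_exp (x := n) (by positivity) n
  have h2 := Real.log_le_log (by positivity) h
  rw [Real.log_exp, Real.log_div (by positivity) (by positivity), Real.log_pow] at h2
  linarith

/-- Permutations act on words by `σ ↦ f ∘ σ`. Each fibre of this map injects into the stabilizer of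
`f`, whose order is the product of factorials. -/
lemma factorial_card_le_mul_ncard_sameType {X A : Type*} [Fintype X] [Fintype A] [DecidableEq A]
    (f : X → A) :
    (Fintype.card X).factorial ≤ (∏ a, (Fintype.card {x // f x = a}).factorial) *
      {g : X → A | ∀ a, Fintype.card {x // g x = a} = Fintype.card {x // f x = a}}.ncard := by
  classical
  rw [← DomMulAct.stabilizer_card, ← Fintype.card_perm, ← Finset.card_univ]
  rw [Set.ncard_eq_toFinset_card']
  refine Finset.card_le_mul_card_image_of_maps_to
    (f := fun σ : Equiv.Perm X => f ∘ σ) ?_ _ ?_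
  · intro σ _
    simp only [Set.mem_toFinset, Set.mem_ofPred_eq]
    intro a
    exact Fintype.card_congr (σ.subtypeEquiv fun x => by simp)
  · intro g _
    rcases (Finset.univ.filter fun σ : Equiv.Perm X => f ∘ σ = g).eq_empty_or_nonempty with h | h
    · simp [h]
    · obtain ⟨τ, hτ⟩ := h
      simp only [Finset.mem_filter, Finset.mem_univ, true_and] at hτ
      rw [Fintype.card_subtype]
      refine Finset.card_le_card_of_injOn (fun σ => σ * τ⁻¹) ?_ ?_
      · intro σ hσ
        simp only [Finset.coe_filter, Finset.mem_univ, true_and, Set.mem_ofPred_eq] at hσ ⊢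
        funext x
        have := congrFun (hσ.trans hτ.symm) (τ⁻¹ x)
        simpa using this
      · intro σ _ σ' _ h
        exact mul_right_cancel h

lemma exists_fiber_card_eq {X A : Type*} [Fintype X] [Fintype A] [DecidableEq A] (n : A → ℕ)
    (hn : ∑ a, n a = Fintype.card X) : ∃ f : X → A, ∀ a, Fintype.card {x // f x = a} = n a := by
  have hcard : Fintype.card X = Fintype.card (Σ a, Fin (n a)) := by simp [hn]
  let e := Fintype.equivOfCardEq hcard
  refine ⟨fun x => (e x).1, fun a => ?_⟩
  rw [← Fintype.card_fin (n a)]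
  refine Fintype.card_congr ((e.subtypeEquiv (q := fun y => y.1 = a) fun x => Iff.rfl).trans
    (Equiv.sigmaSubtype a))

/-- Integer vectors in a rationally defined subspace approximate every multiple of a given real
vector of that subspace, with bounded error and without enlarging the support. -/
lemma exists_int_approx {A d : Type*} [Fintype A] (v : A → d → ℤ) (p : A → ℝ)
    (hp : ∀ i, ∑ a, p a * v a i = 0) :
    ∃ c : ℝ, 0 ≤ c ∧ ∀ M : ℕ, ∃ n : A → ℤ, (∀ i, ∑ a, n a * v a i = 0) ∧
      (∀ a, |(n a : ℝ) - M * p a| ≤ c) ∧ ∀ a, p a = 0 → n a = 0 := by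
  classical
  -- Expanding the entries of `p` in a `ℚ`-basis of their span writes `p` as a real combination of
  -- rational vectors `q l`. Linear independence puts each `q l` in the solution space and makes it
  -- vanish wherever `p` does.
  let V := Submodule.span ℚ (Set.range p)
  have : FiniteDimensional ℚ V := FiniteDimensional.span_of_finite ℚ (Set.finite_range p)
  let b := Module.finBasis ℚ V
  let pV : A → V := fun a => ⟨p a, Submodule.subset_span ⟨a, rfl⟩⟩
  let q : Fin (Module.finrank ℚ V) → A → ℚ := fun l a => b.repr (pV a) l
  have hpq : ∀ a, p a = ∑ l, (q l a : ℝ) * (b l : ℝ) := by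
    intro a
    have h := congrArg (Subtype.val) (b.sum_repr (pV a))
    rw [AddSubmonoidClass.coe_finsetSum] at h
    rw [show p a = (pV a : ℝ) from rfl, ← h]
    refine Finset.sum_congr rfl fun l _ => ?_
    rw [Submodule.coe_smul, Rat.smul_def]
  have hq0 : ∀ i l, ∑ a, q l a * v a i = 0 := by
    intro i l
    have h0 : ∑ a, (v a i : ℚ) • pV a = 0 := by
      apply Subtype.ext
      rw [AddSubmonoidClass.coe_finsetSum, Submodule.coe_zero, ← hp i]
      refine Finset.sum_congr rfl fun a _ => ?_
      rw [Submodule.coe_smul, Rat.smul_def, mul_comm]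
      simp [pV]
    have h1 := congrArg (fun x => b.repr x l) h0
    simp only [map_sum, map_smul, Finsupp.coe_finsetSum, Finset.sum_apply, Finsupp.smul_apply, map_zero,
      Finsupp.coe_zero, Pi.zero_apply, smul_eq_mul] at h1
    rw [← h1]
    exact Finset.sum_congr rfl fun a _ => mul_comm _ _
  let Q : ℕ := ∏ l, ∏ a, (q l a).den
  have hQ : 0 < Q := Finset.prod_pos fun l _ => Finset.prod_pos fun a _ => (q l a).den_pos
  have hz : ∀ l a, ∃ z : ℤ, (z : ℚ) = Q * q l a := by
    intro l a
    have hd : (q l a).den ∣ Q := (Finset.dvd_prod_of_mem (fun a => (q l a).den)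
      (Finset.mem_univ a)).trans
        (Finset.dvd_prod_of_mem (fun l => ∏ a, (q l a).den) (Finset.mem_univ l))
    obtain ⟨k, hk⟩ := hd
    refine ⟨k * (q l a).num, ?_⟩
    rw [hk]
    push_cast
    rw [mul_comm ((q l a).den : ℚ), mul_assoc, Rat.den_mul_eq_num]
  choose z hz using hz
  let lam : Fin (Module.finrank ℚ V) → ℝ := fun l => (b l : ℝ) / Q
  have hQR : (Q : ℝ) ≠ 0 := by positivity
  have hpz : ∀ a, p a = ∑ l, lam l * z l a := by
    intro a
    rw [hpq a]
    refine Finset.sum_congr rfl fun l _ => ?_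
    have : (z l a : ℝ) = Q * (q l a : ℝ) := by exact_mod_cast congrArg (Rat.cast (K := ℝ)) (hz l a)
    rw [this]
    simp only [lam]
    field_simp
  -- Rounding the coefficients `M * lam l`, rather than the entries, stays in the solution space.
  refine ⟨∑ a, ∑ l, |(z l a : ℝ)|, by positivity, fun M =>
    ⟨fun a => ∑ l, ⌊M * lam l⌋ * z l a, fun i => ?_, fun a => ?_, fun a ha => ?_⟩⟩
  · have hzv : ∀ l, ∑ a, z l a * v a i = 0 := by
      intro l
      have : ((∑ a, z l a * v a i : ℤ) : ℚ) = Q * ∑ a, q l a * v a i := by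
        push_cast
        rw [Finset.mul_sum]
        exact Finset.sum_congr rfl fun a _ => by rw [hz l a]; ring
      rw [hq0 i l, mul_zero] at this
      exact_mod_cast this
    simp only [Finset.sum_mul]
    rw [Finset.sum_comm]
    simp only [mul_assoc, ← Finset.mul_sum, hzv, mul_zero, Finset.sum_const_zero]
  · have h1 : ((∑ l, ⌊M * lam l⌋ * z l a : ℤ) : ℝ) - M * p a
        = ∑ l, ((⌊M * lam l⌋ : ℝ) - M * lam l) * z l a := by
      rw [hpz a, Finset.mul_sum]
      push_cast
      rw [← Finset.sum_sub_distrib]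
      exact Finset.sum_congr rfl fun l _ => by ring
    rw [h1]
    refine (Finset.abs_sum_le_sum_abs _ _).trans ?_
    refine le_trans (Finset.sum_le_sum fun l _ => ?_)
      (Finset.single_le_sum (f := fun a => ∑ l, |(z l a : ℝ)|)
        (fun a _ => Finset.sum_nonneg fun l _ => abs_nonneg _) (Finset.mem_univ a))
    rw [abs_mul]
    refine mul_le_of_le_one_left (abs_nonneg _) ?_
    rw [abs_le]
    constructor <;> linarith [Int.floor_le (M * lam l), Int.lt_floor_add_one (M * lam l)]
  · have hpa : pV a = 0 := Subtype.ext ha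
    refine Finset.sum_eq_zero fun l _ => ?_
    have : (z l a : ℚ) = 0 := by rw [hz l a]; simp [q, hpa]
    rw [show z l a = 0 by exact_mod_cast this, mul_zero]

lemma sum_comp_eq_sum_fiber_card {X A : Type*} [Fintype X] [Fintype A] [DecidableEq A]
    (g : X → A) (w : A → ℤ) : ∑ x, w (g x) = ∑ a, (Fintype.card {x // g x = a} : ℤ) * w a := by
  rw [← Finset.sum_fiberwise' Finset.univ g w]
  refine Finset.sum_congr rfl fun a _ => ?_
  rw [Finset.sum_const, nsmul_eq_mul, Fintype.card_subtype]

/-- The loss does not depend on `M`. For `p = 0` it is zero by the conventions `c / 0 = 0` and `log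
0 = 0`. -/
lemma mul_log_div_ge {M n p c : ℝ} (hM : 0 < M) (hn : 0 ≤ n) (hnM : n ≤ M) (hp : 0 ≤ p)
    (hp1 : p ≤ 1) (hc : 0 ≤ c) (h : |n - M * p| ≤ c) :
    M * Real.negMulLog p - (c / p - c * Real.log p) ≤ n * Real.log M - n * Real.log n := by
  have hlogn : n * Real.log n ≤ n * Real.log M := by
    rcases hn.eq_or_lt with rfl | hn
    · simp
    · gcongr
  rcases hp.eq_or_lt with rfl | hp
  · simp; linarith
  rw [abs_le] at h
  rcases hn.eq_or_lt with rfl | hn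
  · have : Real.log p ≤ 0 := Real.log_nonpos hp.le hp1
    have h2 : 0 ≤ c / p := by positivity
    simp only [Real.negMulLog]
    nlinarith
  have hle : Real.log n ≤ Real.log M + Real.log p + c / (M * p) := by
    have h1 : n ≤ M * p * (1 + c / (M * p)) := by
      have : M * p * (1 + c / (M * p)) = M * p + c := by field_simp
      linarith
    have h2 := Real.log_le_log hn h1
    rw [Real.log_mul (by positivity) (by positivity), Real.log_mul hM.ne' hp.ne'] at h2
    have h3 := Real.log_le_sub_one_of_pos (show 0 < 1 + c / (M * p) by positivity)
    linarith
  have hlogp : Real.log p ≤ 0 := Real.log_nonpos hp.le hp1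
  have e1 : n * (c / (M * p)) ≤ c / p := by
    calc n * (c / (M * p)) ≤ M * (c / (M * p)) := by gcongr
      _ = c / p := by field_simp
  have e2 : n * Real.log n ≤ n * (Real.log M + Real.log p + c / (M * p)) := by gcongr
  have e3 : -n * Real.log p ≥ (M * p - c) * -Real.log p := by nlinarith
  simp only [Real.negMulLog]
  nlinarith

/-- Stirling bounds for the multinomial coefficient; the linear terms cancel because the fibre sizes
add up to `|X|`. -/
lemma log_ncard_sameType_ge {X A : Type*} [Fintype X] [Fintype A] [DecidableEq A]
    (f : X → A) :
    ∑ a, ((Fintype.card {x // f x = a} : ℝ) * Real.log (Fintype.card X)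
      - (Fintype.card {x // f x = a} : ℝ) * Real.log (Fintype.card {x // f x = a}))
      - Fintype.card A * (Real.log (Fintype.card X + 1) + 1) ≤
    Real.log {g : X → A | ∀ a, Fintype.card {x // g x = a} = Fintype.card {x // f x = a}}.ncard := by
  have hcount := factorial_card_le_mul_ncard_sameType f
  set S := {g : X → A | ∀ a, Fintype.card {x // g x = a} = Fintype.card {x // f x = a}} with hS
  have hSpos : 0 < S.ncard := (Set.ncard_pos (Set.toFinite S)).2 ⟨f, fun a => rfl⟩
  have h1 : Real.log (Fintype.card X).factorial ≤
      ∑ a, Real.log (Fintype.card {x // f x = a}).factorial + Real.log S.ncard := by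
    have h := Real.log_le_log (by positivity) (show (((Fintype.card X).factorial : ℕ) : ℝ) ≤ _ from
      Nat.cast_le.2 hcount)
    push_cast at h
    rwa [Real.log_mul (Finset.prod_ne_zero_iff.2 fun a _ => by positivity) (by positivity),
      Real.log_prod (fun a _ => by positivity)] at h
  have hsum : ∑ a, (Fintype.card {x // f x = a} : ℝ) = Fintype.card X := by
    rw [← Nat.cast_sum, ← Fintype.card_sigma]
    exact_mod_cast Fintype.card_congr (Equiv.sigmaFiberEquiv f)
  have h2 := le_log_factorial (Fintype.card X)
  have h3 : ∑ a, Real.log (Fintype.card {x // f x = a}).factorial ≤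
      ∑ a, ((Fintype.card {x // f x = a} : ℝ) * Real.log (Fintype.card {x // f x = a})
        - Fintype.card {x // f x = a} + (Real.log (Fintype.card X + 1) + 1)) := by
    refine Finset.sum_le_sum fun a _ => (log_factorial_le _).trans ?_
    have : Real.log ((Fintype.card {x // f x = a} : ℝ) + 1) ≤ Real.log (Fintype.card X + 1) := by
      have hle : Fintype.card {x // f x = a} ≤ Fintype.card X := Fintype.card_subtype_le _
      gcongr
    linarith
  rw [Finset.sum_add_distrib, Finset.sum_sub_distrib, hsum, Finset.sum_const, Finset.card_univ,
    nsmul_eq_mul] at h3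
  rw [Finset.sum_sub_distrib, ← Finset.sum_mul, hsum]
  linarith

/-- Natural types of size `M` with mean zero, close to `M • p`. -/
lemma exists_type_approx {A d : Type*} [Fintype A] (v : A → d → ℤ) (a₀ : A)
    (ha₀ : v a₀ = 0) (p : A → ℝ) (hp : p ∈ stdSimplex ℝ A)
    (hmean : ∀ i, ∑ a, p a * v a i = 0) :
    ∃ c : ℝ, 0 ≤ c ∧ ∃ M₀ : ℕ, ∀ M : ℕ, M₀ ≤ M → ∃ n : A → ℕ, ∑ a, n a = M ∧
      (∀ i, ∑ a, (n a : ℤ) * v a i = 0) ∧ ∀ a, |(n a : ℝ) - M * p a| ≤ c := by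
  classical
  obtain ⟨c₀, hc₀, happrox⟩ := exists_int_approx v p hmean
  obtain ⟨e, he⟩ := exists_nat_ge (c₀ * Fintype.card A)
  have hbig : ∃ M₁ : ℕ, ∀ a, p a ≠ 0 → c₀ ≤ M₁ * p a := by
    obtain ⟨M₁, hM₁⟩ := exists_nat_ge (∑ a, c₀ / p a)
    refine ⟨M₁, fun a ha => ?_⟩
    have hpa : 0 < p a := lt_of_le_of_ne (hp.1 a) ha.symm
    rw [← div_le_iff₀ hpa]
    exact (Finset.single_le_sum (f := fun a => c₀ / p a)
      (fun a _ => div_nonneg hc₀ (hp.1 a)) (Finset.mem_univ a)).trans hM₁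
  obtain ⟨M₁, hM₁⟩ := hbig
  -- Approximate at size `M' = M - e`, so that the missing mass `r` lies in `[0, 2e]`, and give it
  -- to the weightless letter `a₀`. The bound `M₁` keeps the counts nonnegative on the support of
  -- `p`.
  refine ⟨c₀ + 3 * e, by positivity, M₁ + e, fun M hM => ?_⟩
  obtain ⟨M', rfl⟩ := Nat.exists_eq_add_of_le (show e ≤ M by omega)
  obtain ⟨n, hn0, hnc, hns⟩ := happrox M'
  have hnn : ∀ a, 0 ≤ n a := by
    intro a
    by_cases ha : p a = 0
    · rw [hns a ha]
    · have h1 := (abs_le.1 (hnc a)).1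
      have h2 : (M₁ : ℝ) * p a ≤ M' * p a := by
        have : (M₁ : ℝ) ≤ M' := by exact_mod_cast (by omega : M₁ ≤ M')
        exact mul_le_mul_of_nonneg_right this (hp.1 a)
      have h3 := hM₁ a ha
      have : (0 : ℝ) ≤ n a := by linarith
      exact_mod_cast this
  have hN : |((∑ a, n a : ℤ) : ℝ) - M'| ≤ e := by
    have : ((∑ a, n a : ℤ) : ℝ) - M' = ∑ a, ((n a : ℝ) - M' * p a) := by
      rw [Finset.sum_sub_distrib, ← Finset.mul_sum, hp.2, mul_one]; push_cast; rfl
    rw [this]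
    refine (Finset.abs_sum_le_sum_abs _ _).trans ((Finset.sum_le_sum fun a _ => hnc a).trans ?_)
    rw [Finset.sum_const, Finset.card_univ, nsmul_eq_mul]
    linarith
  have hN1 : (∑ a, n a) ≤ M' + e := by
    have := (abs_le.1 hN).2
    have : ((∑ a, n a : ℤ) : ℝ) ≤ ((M' + e : ℤ) : ℝ) := by push_cast at *; linarith
    exact_mod_cast this
  have hN2 : (M' : ℤ) - e ≤ ∑ a, n a := by
    have := (abs_le.1 hN).1
    have : ((M' - e : ℤ) : ℝ) ≤ ((∑ a, n a : ℤ) : ℝ) := by push_cast at *; linarith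
    exact_mod_cast this
  set r : ℤ := e + M' - ∑ a, n a with hr
  have hcast : ∀ a, (((n a + if a = a₀ then r else 0).toNat : ℕ) : ℤ)
      = n a + if a = a₀ then r else 0 := by
    intro a
    have := hnn a
    split_ifs <;> omega
  refine ⟨fun a => (n a + if a = a₀ then r else 0).toNat, ?_, fun i => ?_, fun a => ?_⟩
  · zify
    simp only [hcast, Finset.sum_add_distrib, Finset.sum_ite_eq', Finset.mem_univ, if_true]
    rw [hr]; ring
  · simp only [hcast, add_mul, Finset.sum_add_distrib, hn0, ite_mul, zero_mul,
      Finset.sum_ite_eq', Finset.mem_univ, if_true, ha₀, Pi.zero_apply, mul_zero, add_zero]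
  · have h1 : (((n a + if a = a₀ then r else 0).toNat : ℕ) : ℝ)
        = n a + ((if a = a₀ then r else 0 : ℤ) : ℝ) := by exact_mod_cast hcast a
    have h2 : ((if a = a₀ then r else 0 : ℤ) : ℝ) ≤ 2 * e := by
      have : (if a = a₀ then r else 0 : ℤ) ≤ 2 * e := by split_ifs <;> omega
      exact_mod_cast this
    have h3 : (0 : ℝ) ≤ ((if a = a₀ then r else 0 : ℤ) : ℝ) := by
      have : (0 : ℤ) ≤ (if a = a₀ then r else 0 : ℤ) := by split_ifs <;> omega
      exact_mod_cast this
    have h4 := abs_le.1 (hnc a)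
    have h5 : p a ≤ 1 := by
      rw [← hp.2]; exact Finset.single_le_sum (fun a _ => hp.1 a) (Finset.mem_univ a)
    have h6 := hp.1 a
    have h7 : (e : ℝ) * p a ≤ e := mul_le_of_le_one_right (by positivity) h5
    have h8 : 0 ≤ (e : ℝ) * p a := by positivity
    rw [h1, abs_le]
    push_cast at *
    constructor <;> nlinarith

/-- A lower bound, sharp up to a polynomial factor, on the number of words over the alphabet `A`
whose letters `a` have weights `v a` summing to zero. -/
theorem log_ncard_sum_eq_zero_ge {A d : Type*} [Fintype A] [Fintype d] (v : A → d → ℤ) (a₀ : A)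
    (ha₀ : v a₀ = 0) (L : ℝ)
    (hL : ∀ u : d → ℝ, L ≤ Real.log (∑ a, Real.exp (∑ i, u i * v a i))) :
    ∃ c : ℝ, 0 ≤ c ∧ ∀ (X : Type) [Fintype X] [Nonempty X],
      Fintype.card X * L - c * (1 + Real.log (Fintype.card X + 1)) ≤
        Real.log {f : X → A | ∀ i, ∑ x, v (f x) i = 0}.ncard := by
  classical
  obtain ⟨p, hp, hpL, hmean⟩ := exists_maxEntropy (fun a i => (v a i : ℝ)) L a₀
    (by funext i; simp [ha₀]) hL
  obtain ⟨c₁, hc₁, M₀, htype⟩ := exists_type_approx v a₀ ha₀ p hp hmean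
  have hp1 : ∀ a, p a ≤ 1 := fun a => by
    rw [← hp.2]; exact Finset.single_le_sum (fun a _ => hp.1 a) (Finset.mem_univ a)
  set c₂ := ∑ a, (c₁ / p a - c₁ * Real.log (p a)) with hc₂
  have hc₂0 : 0 ≤ c₂ := Finset.sum_nonneg fun a _ => by
    have h1 := Real.log_nonpos (hp.1 a) (hp1 a)
    have h2 := div_nonneg hc₁ (hp.1 a)
    nlinarith
  refine ⟨M₀ * |L| + c₂ + Fintype.card A, by positivity, fun X _ _ => ?_⟩
  have hlog : 0 ≤ Real.log ((Fintype.card X : ℝ) + 1) :=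
    Real.log_nonneg (by linarith [(Fintype.card X).cast_nonneg (α := ℝ)])
  have hM : 0 < Fintype.card X := Fintype.card_pos
  have hML : (Fintype.card X : ℝ) * L ≤ Fintype.card X * |L| := by
    gcongr; exact le_abs_self L
  -- Below the threshold the term `M₀ * |L|` of the constant already makes the left side
  -- nonpositive.
  rcases lt_or_ge (Fintype.card X) M₀ with hlt | hge
  · have h1 : 0 ≤ Real.log ({f : X → A | ∀ i, ∑ x, v (f x) i = 0}.ncard : ℝ) :=
      Real.log_natCast_nonneg _
    have h2 : (Fintype.card X : ℝ) * |L| ≤ M₀ * |L| := by gcongr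
    have h3 : 0 ≤ (M₀ * |L| + c₂ + Fintype.card A) * Real.log ((Fintype.card X : ℝ) + 1) := by
      positivity
    have h4 : (0 : ℝ) ≤ Fintype.card A := by positivity
    linarith
  · obtain ⟨n, hnM, hn0, hnc⟩ := htype _ hge
    obtain ⟨f, hf⟩ := exists_fiber_card_eq n hnM
    have h1 := log_ncard_sameType_ge f
    have hsub : {g : X → A | ∀ a, Fintype.card {x // g x = a} = Fintype.card {x // f x = a}} ⊆
        {f : X → A | ∀ i, ∑ x, v (f x) i = 0} := by
      intro g hg i
      rw [sum_comp_eq_sum_fiber_card g (fun a => v a i), ← hn0 i]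
      exact Finset.sum_congr rfl fun a _ => by rw [hg a, hf a]
    have h2 : Real.log ({g : X → A | ∀ a,
          Fintype.card {x // g x = a} = Fintype.card {x // f x = a}}.ncard : ℝ) ≤
        Real.log ({f : X → A | ∀ i, ∑ x, v (f x) i = 0}.ncard : ℝ) := by
      refine Real.log_le_log ?_ (by exact_mod_cast Set.ncard_le_ncard hsub (Set.toFinite _))
      exact Nat.cast_pos.2 ((Set.ncard_pos (Set.toFinite _)).2 ⟨f, fun a => rfl⟩)
    simp only [hf] at h1 h2
    have h3 : Fintype.card X * ∑ a, Real.negMulLog (p a) - c₂ ≤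
        ∑ a, ((n a : ℝ) * Real.log (Fintype.card X) - n a * Real.log (n a)) := by
      rw [hc₂, Finset.mul_sum, ← Finset.sum_sub_distrib]
      refine Finset.sum_le_sum fun a _ => mul_log_div_ge (by positivity) (by positivity) ?_
        (hp.1 a) (hp1 a) hc₁ (hnc a)
      have : n a ≤ Fintype.card X := by
        rw [← hnM]; exact Finset.single_le_sum (fun a _ => Nat.zero_le _) (Finset.mem_univ a)
      exact_mod_cast this
    have h4 : (Fintype.card X : ℝ) * L ≤ Fintype.card X * ∑ a, Real.negMulLog (p a) := by gcongr
    have h5 : 0 ≤ (M₀ * |L| + c₂) * Real.log ((Fintype.card X : ℝ) + 1) := by positivity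
    have h6 : 0 ≤ M₀ * |L| := by positivity
    linarith

/-! ### The generating function as a sum over bounded matrices. -/

lemma tableGenFun_eq_sum {ι κ : Type*} [Fintype ι] [Fintype κ]
    [DecidableEq ι] [DecidableEq κ]
    (K : Matrix ι κ ℕ) (x : ι → ℝ) (y : κ → ℝ) :
    tableGenFun K x y = ∑ A : (∀ i j, Fin (K i j + 1)),
      (∏ i, x i ^ (∑ j, (A i j : ℕ))) * ∏ j, y j ^ (∑ i, (A i j : ℕ)) := by
  unfold tableGenFun
  have h1 : ∀ i, ∏ j, ∑ t ∈ Finset.range (K i j + 1), (x i * y j) ^ t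
      = ∑ a : (∀ j, Fin (K i j + 1)), ∏ j, (x i * y j) ^ (a j : ℕ) := by
    intro i
    simp only [Finset.sum_range]
    rw [Finset.prod_univ_sum, Fintype.piFinset_univ]
  simp only [h1]
  rw [Finset.prod_univ_sum, Fintype.piFinset_univ]
  refine Finset.sum_congr rfl fun A _ => ?_
  simp only [mul_pow, Finset.prod_mul_distrib, Finset.prod_pow_eq_pow_sum]
  congr 1
  rw [Finset.prod_comm]
  simp only [Finset.prod_pow_eq_pow_sum]

lemma tableCount_eq_ncard_pi {ι κ : Type*} [Fintype ι] [Fintype κ]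
    (K : Matrix ι κ ℕ) (R : ι → ℕ) (C : κ → ℕ) :
    tableCount K R C = {A : (∀ i j, Fin (K i j + 1)) | (∀ i, ∑ j, (A i j : ℕ) = R i) ∧
      ∀ j, ∑ i, (A i j : ℕ) = C j}.ncard := by
  symm
  refine Set.ncard_congr (fun A _ i j => (A i j : ℕ)) ?_ ?_ ?_
  · rintro A ⟨h1, h2⟩
    exact ⟨h1, h2, fun i j => Nat.lt_succ_iff.1 (A i j).2⟩
  · intro A B _ _ h
    funext i j
    exact Fin.ext (congrFun (congrFun h i) j)
  · rintro A ⟨h1, h2, h3⟩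
    exact ⟨fun i j => ⟨A i j, Nat.lt_succ_iff.2 (h3 i j)⟩, ⟨h1, h2⟩, rfl⟩

lemma tableCount_mul_le_tableGenFun {ι κ : Type*} [Fintype ι] [Fintype κ]
    (K : Matrix ι κ ℕ) (R : ι → ℕ) (C : κ → ℕ) {x : ι → ℝ} {y : κ → ℝ}
    (hx : ∀ i, 0 < x i) (hy : ∀ j, 0 < y j) :
    (tableCount K R C : ℝ) * ((∏ i, x i ^ R i) * ∏ j, y j ^ C j) ≤ tableGenFun K x y := by
  classical
  rw [tableGenFun_eq_sum, tableCount_eq_ncard_pi, Set.ncard_eq_toFinset_card', ← nsmul_eq_mul,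
    ← Finset.sum_const]
  refine le_trans (le_of_eq (Finset.sum_congr rfl fun A hA => ?_))
    (Finset.sum_le_sum_of_subset_of_nonneg (Finset.subset_univ _) fun A _ _ => ?_)
  · have h : (∀ i, ∑ j, (A i j : ℕ) = R i) ∧ ∀ j, ∑ i, (A i j : ℕ) = C j := by simpa using hA
    simp only [h.1, h.2]
  · exact mul_nonneg (Finset.prod_nonneg fun i _ => pow_nonneg (hx i).le _)
      (Finset.prod_nonneg fun j _ => pow_nonneg (hy j).le _)

lemma tableCount_le_genFun_div {ι κ : Type*} [Fintype ι] [Fintype κ]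
    (K : Matrix ι κ ℕ) (R : ι → ℕ) (C : κ → ℕ) {x : ι → ℝ} {y : κ → ℝ}
    (hx : ∀ i, 0 < x i) (hy : ∀ j, 0 < y j) :
    (tableCount K R C : ℝ) ≤ tableGenFun K x y / ((∏ i, x i ^ R i) * ∏ j, y j ^ C j) := by
  rw [le_div_iff₀ (mul_pos (Finset.prod_pos fun i _ => pow_pos (hx i) _)
    (Finset.prod_pos fun j _ => pow_pos (hy j) _))]
  exact tableCount_mul_le_tableGenFun K R C hx hy

lemma le_genFunInf {ι κ : Type*} [Fintype ι] [Fintype κ]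
    (K : Matrix ι κ ℕ) (R : ι → ℕ) (C : κ → ℕ) {t : ℝ}
    (h : ∀ (x : ι → ℝ) (y : κ → ℝ), (∀ i, 0 < x i) → (∀ j, 0 < y j) →
      t ≤ tableGenFun K x y / ((∏ i, x i ^ R i) * ∏ j, y j ^ C j)) :
    t ≤ genFunInf K R C := by
  refine le_csInf ⟨_, fun _ => 1, fun _ => 1, fun _ => one_pos, fun _ => one_pos, rfl⟩ ?_
  rintro v ⟨x, y, hx, hy, rfl⟩
  exact h x y hx hy

lemma genFunInf_le {ι κ : Type*} [Fintype ι] [Fintype κ]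
    (K : Matrix ι κ ℕ) (R : ι → ℕ) (C : κ → ℕ) {x : ι → ℝ} {y : κ → ℝ}
    (hx : ∀ i, 0 < x i) (hy : ∀ j, 0 < y j) :
    genFunInf K R C ≤ tableGenFun K x y / ((∏ i, x i ^ R i) * ∏ j, y j ^ C j) := by
  refine csInf_le ⟨0, ?_⟩ ⟨x, y, hx, hy, rfl⟩
  rintro v ⟨x, y, hx, hy, rfl⟩
  exact (Nat.cast_nonneg _).trans (tableCount_le_genFun_div K R C hx hy)

/-- The difference between the margins of a `K`-bounded matrix and the margins `R`, `C`. -/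
def marginDefect {ι κ : Type*} [Fintype ι] [Fintype κ] (K : Matrix ι κ ℕ) (R : ι → ℕ) (C : κ → ℕ)
    (A : ∀ i j, Fin (K i j + 1)) : ι ⊕ κ → ℤ :=
  Sum.elim (fun i => (∑ j, (A i j : ℕ) : ℕ) - (R i : ℤ))
    (fun j => (∑ i, (A i j : ℕ) : ℕ) - (C j : ℤ))

/-- This substitution makes the infimum a bound on a partition function, the form required by the
word count. -/
lemma genFun_div_eq_sum_exp {ι κ : Type*} [Fintype ι] [Fintype κ]
    [DecidableEq ι] [DecidableEq κ]
    (K : Matrix ι κ ℕ) (R : ι → ℕ) (C : κ → ℕ) (u : ι ⊕ κ → ℝ) :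
    tableGenFun K (fun i => Real.exp (u (.inl i))) (fun j => Real.exp (u (.inr j))) /
      ((∏ i, Real.exp (u (.inl i)) ^ R i) * ∏ j, Real.exp (u (.inr j)) ^ C j)
      = ∑ A, Real.exp (∑ i, u i * marginDefect K R C A i) := by
  rw [tableGenFun_eq_sum, Finset.sum_div]
  refine Finset.sum_congr rfl fun A _ => ?_
  simp only [← Real.exp_nat_mul, ← Real.exp_sum, ← Real.exp_add, ← Real.exp_sub,
    Fintype.sum_sum_type, marginDefect, Sum.elim_inl, Sum.elim_inr]
  congr 1
  rw [add_sub_add_comm, ← Finset.sum_sub_distrib, ← Finset.sum_sub_distrib]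
  congr 1 <;> exact Finset.sum_congr rfl fun i _ => by push_cast; ring

lemma log_genFunInf_le {ι κ : Type*} [Fintype ι] [Fintype κ]
    [DecidableEq ι] [DecidableEq κ]
    (K : Matrix ι κ ℕ) (R : ι → ℕ) (C : κ → ℕ) (hpos : 0 < genFunInf K R C) (u : ι ⊕ κ → ℝ) :
    Real.log (genFunInf K R C) ≤
      Real.log (∑ A, Real.exp (∑ i, u i * marginDefect K R C A i)) := by
  rw [← genFun_div_eq_sum_exp]
  exact Real.log_le_log hpos
    (genFunInf_le K R C (fun i => Real.exp_pos _) (fun j => Real.exp_pos _))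

lemma tableCount_submatrix {ι κ ι' κ' : Type*} [Fintype ι] [Fintype κ] [Fintype ι'] [Fintype κ']
    (e : ι' ≃ ι) (f : κ' ≃ κ) (K : Matrix ι κ ℕ) (R : ι → ℕ) (C : κ → ℕ) :
    tableCount (K.submatrix e f) (R ∘ e) (C ∘ f) = tableCount K R C := by
  symm
  refine Set.ncard_congr (fun A _ => A.submatrix e f) ?_ ?_ ?_
  · rintro A ⟨h1, h2, h3⟩
    refine ⟨fun i => ?_, fun j => ?_, fun i j => h3 _ _⟩
    · rw [Function.comp_apply, ← h1]; exact f.sum_comp (A (e i))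
    · rw [Function.comp_apply, ← h2]; exact e.sum_comp (fun i => A i (f j))
  · intro A B _ _ h
    ext i j
    simpa using congrFun (congrFun h (e.symm i)) (f.symm j)
  · rintro A ⟨h1, h2, h3⟩
    refine ⟨A.submatrix e.symm f.symm, ⟨fun i => ?_, fun j => ?_, fun i j => ?_⟩, ?_⟩
    · have := h1 (e.symm i)
      simp only [Function.comp_apply, Equiv.apply_symm_apply] at this
      rw [← this]; exact f.symm.sum_comp (A (e.symm i))
    · have := h2 (f.symm j)
      simp only [Function.comp_apply, Equiv.apply_symm_apply] at this
      rw [← this]; exact e.symm.sum_comp (fun i => A i (f.symm j))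
    · simpa using h3 (e.symm i) (f.symm j)
    · ext i j; simp

/-! ### Upper and lower bounds for cloned tables. -/

/-- The block matrix with `s × s` blocks equal to `K`, indexed by pairs (block, position). -/
def blockClone {ι κ : Type*} (s : ℕ) (K : Matrix ι κ ℕ) : Matrix (Fin s × ι) (Fin s × κ) ℕ :=
  fun a b => K a.2 b.2

lemma tableCount_clone {m n : ℕ} (s : ℕ) (R : Fin m → ℕ) (C : Fin n → ℕ)
    (K : Matrix (Fin m) (Fin n) ℕ) :
    tableCount (cloneMatrix s K) (cloneMargin s R) (cloneMargin s C) =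
      tableCount (blockClone s K) (fun a => s * R a.2) (fun b => s * C b.2) :=
  tableCount_submatrix finProdFinEquiv.symm finProdFinEquiv.symm (blockClone s K)
    (fun a => s * R a.2) (fun b => s * C b.2)

lemma tableCount_blockClone_pos {ι κ : Type*} [Fintype ι] [Fintype κ] (s : ℕ)
    (K : Matrix ι κ ℕ) (R : ι → ℕ) (C : κ → ℕ) (hT : 0 < tableCount K R C) :
    0 < tableCount (blockClone s K) (fun a => s * R a.2) (fun b => s * C b.2) := by
  obtain ⟨A, h1, h2, h3⟩ := (Set.ncard_pos (boundedTables_finite K R C)).1 hT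
  refine (Set.ncard_pos (boundedTables_finite _ _ _)).2
    ⟨fun a b => A a.2 b.2, fun a => ?_, fun b => ?_, fun a b => h3 _ _⟩
  · rw [Fintype.sum_prod_type]; simp [h1]
  · rw [Fintype.sum_prod_type]; simp [h2]

lemma prod_clone_pow {α : Type*} [Fintype α] (s : ℕ) (z : α → ℝ) (D : α → ℕ) :
    ∏ a : Fin s × α, z a.2 ^ (s * D a.2) = (∏ a, z a ^ D a) ^ s ^ 2 := by
  rw [Fintype.prod_prod_type]
  simp only [Finset.prod_const, Finset.card_univ, Fintype.card_fin]
  simp only [mul_comm s, pow_mul, Finset.prod_pow]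
  rw [← pow_mul, sq]

lemma tableGenFun_blockClone {ι κ : Type*} [Fintype ι] [Fintype κ] (s : ℕ)
    (K : Matrix ι κ ℕ) (x : ι → ℝ) (y : κ → ℝ) :
    tableGenFun (blockClone s K) (fun a => x a.2) (fun b => y b.2) = tableGenFun K x y ^ s ^ 2 := by
  unfold tableGenFun blockClone
  simp only [Fintype.prod_prod_type, Finset.prod_const, Finset.card_univ, Fintype.card_fin,
    Finset.prod_pow]
  rw [← pow_mul, sq]

lemma tableCount_blockClone_le {ι κ : Type*} [Fintype ι] [Fintype κ] (s : ℕ)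
    (K : Matrix ι κ ℕ) (R : ι → ℕ) (C : κ → ℕ) {x : ι → ℝ} {y : κ → ℝ}
    (hx : ∀ i, 0 < x i) (hy : ∀ j, 0 < y j) :
    (tableCount (blockClone s K) (fun a => s * R a.2) (fun b => s * C b.2) : ℝ) ≤
      (tableGenFun K x y / ((∏ i, x i ^ R i) * ∏ j, y j ^ C j)) ^ (s ^ 2) := by
  have h := tableCount_le_genFun_div (blockClone s K) (fun a => s * R a.2) (fun b => s * C b.2)
    (x := fun a => x a.2) (y := fun b => y b.2) (fun a => hx a.2) (fun b => hy b.2)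
  refine h.trans (le_of_eq ?_)
  rw [div_pow, mul_pow, prod_clone_pow, prod_clone_pow, tableGenFun_blockClone]

/-- The `s²`-th root of the count lies below every value of the quotient, hence below its infimum.
-/
lemma log_tableCount_blockClone_le {ι κ : Type*} [Fintype ι] [Fintype κ] {s : ℕ} (hs : 0 < s)
    (K : Matrix ι κ ℕ) (R : ι → ℕ) (C : κ → ℕ) (hT : 0 < tableCount K R C) :
    Real.log (tableCount (blockClone s K) (fun a => s * R a.2) (fun b => s * C b.2)) ≤
      s ^ 2 * Real.log (genFunInf K R C) := by
  have hpos : (0 : ℝ) < tableCount (blockClone s K) (fun a => s * R a.2) (fun b => s * C b.2) :=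
    Nat.cast_pos.2 (tableCount_blockClone_pos s K R C hT)
  set T : ℝ := ((tableCount (blockClone s K) (fun a => s * R a.2) (fun b => s * C b.2) : ℕ) : ℝ)
  have hs2 : (0 : ℝ) < (s : ℝ) ^ 2 := by positivity
  have key : Real.exp (Real.log T / s ^ 2) ≤ genFunInf K R C := by
    refine le_genFunInf K R C fun x y hx hy => ?_
    have hv : 0 < tableGenFun K x y / ((∏ i, x i ^ R i) * ∏ j, y j ^ C j) :=
      lt_of_lt_of_le (Nat.cast_pos.2 hT) (tableCount_le_genFun_div K R C hx hy)
    rw [← Real.le_log_iff_exp_le hv, div_le_iff₀ hs2]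
    have := Real.log_le_log hpos (tableCount_blockClone_le s K R C hx hy)
    rw [Real.log_pow] at this
    push_cast at this
    linarith
  have := (Real.le_log_iff_exp_le (lt_of_lt_of_le (Real.exp_pos _) key)).2 key
  rw [div_le_iff₀ hs2] at this
  linarith

lemma sum_snd_fiber {α : Type*} [Fintype α] [DecidableEq α] {s : ℕ} (g : Fin s × α → ℕ) (i : α) :
    ∑ a with a.2 = i, g a = ∑ b, g (b, i) := by
  rw [Finset.sum_filter, Fintype.sum_prod_type]
  simp

/-- Among all margins with given sums over the clones of each row and of each column, the uniform
ones maximize the number of tables. -/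
lemma tableCount_blockClone_le_uniform {ι κ : Type*} [Fintype ι] [Fintype κ] (s : ℕ)
    (K : Matrix ι κ ℕ) (R : ι → ℕ) (C : κ → ℕ) (R' : Fin s × ι → ℕ) (C' : Fin s × κ → ℕ)
    (hR : ∀ i, ∑ b, R' (b, i) = s * (s * R i)) (hC : ∀ j, ∑ b, C' (b, j) = s * (s * C j)) :
    tableCount (blockClone s K) R' C' ≤
      tableCount (blockClone s K) (fun a => s * R a.2) (fun b => s * C b.2) := by
  classical
  have h1 : tableCount (blockClone s K) R' C' ≤
      tableCount (blockClone s K) R' (fun b => s * C b.2) := by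
    refine tableCount_le_of_fiber_const Prod.snd (blockClone s K) R'
      (fun j₁ j₂ h i => by simp only [blockClone, h]) _ (fun j₁ j₂ h => by simp only [h]) _
      C' rfl fun q => ?_
    refine (sum_snd_fiber C' q).trans (((hC q).trans ?_).trans (sum_snd_fiber _ q).symm)
    simp
  refine h1.trans ?_
  rw [← tableCount_transpose, ← tableCount_transpose (blockClone s K) (fun a => s * R a.2)]
  refine tableCount_le_of_fiber_const Prod.snd (blockClone s K).transpose _
    (fun j₁ j₂ h i => by simp only [Matrix.transpose_apply, blockClone, h]) _
    (fun j₁ j₂ h => by simp only [h]) _ R' rfl fun q => ?_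
  refine (sum_snd_fiber R' q).trans (((hR q).trans ?_).trans (sum_snd_fiber _ q).symm)
  simp

/-- The letter at `(a, b)` is the block in that position. Words are sorted by the margins of the
assembled matrix, whose `s(|ι| + |κ|)` entries are at most `sQ`; zero total defect fixes the margin
sums over clones, so the uniform margin dominates each class. -/
lemma ncard_words_le {ι κ : Type*} [Fintype ι] [Fintype κ] (s : ℕ)
    (K : Matrix ι κ ℕ) (R : ι → ℕ) (C : κ → ℕ) :
    {f : Fin s × Fin s → ∀ i j, Fin (K i j + 1) |
      ∀ i, ∑ x, marginDefect K R C (f x) i = 0}.ncard ≤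
    tableCount (blockClone s K) (fun a => s * R a.2) (fun b => s * C b.2) *
      (s * (∑ i, ∑ j, K i j) + 1) ^ (s * (Fintype.card ι + Fintype.card κ)) := by
  classical
  set Q := ∑ i, ∑ j, K i j with hQ
  have hf1 : ∀ (A : ∀ i j, Fin (K i j + 1)) i, ∑ j, (A i j : ℕ) ≤ Q := by
    intro A i
    refine le_trans (Finset.sum_le_sum fun j _ => Nat.lt_succ_iff.1 (A i j).2) ?_
    exact Finset.single_le_sum (f := fun i => ∑ j, K i j) (fun _ _ => Nat.zero_le _)
      (Finset.mem_univ i)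
  have hf2 : ∀ (A : ∀ i j, Fin (K i j + 1)) j, ∑ i, (A i j : ℕ) ≤ Q := by
    intro A j
    refine le_trans (Finset.sum_le_sum fun i _ => Nat.lt_succ_iff.1 (A i j).2) ?_
    rw [show Q = ∑ j, ∑ i, K i j from Finset.sum_comm]
    exact Finset.single_le_sum (f := fun j => ∑ i, K i j) (fun _ _ => Nat.zero_le _)
      (Finset.mem_univ j)
  let rowM : (Fin s × Fin s → ∀ i j, Fin (K i j + 1)) → Fin s × ι → ℕ :=
    fun f a => ∑ b, ∑ j, (f (a.1, b) a.2 j : ℕ)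
  let colM : (Fin s × Fin s → ∀ i j, Fin (K i j + 1)) → Fin s × κ → ℕ :=
    fun f b => ∑ a, ∑ i, (f (a, b.1) i b.2 : ℕ)
  let box : Finset ((Fin s × ι → ℕ) × (Fin s × κ → ℕ)) :=
    (Fintype.piFinset fun _ => Finset.range (s * Q + 1)) ×ˢ
      (Fintype.piFinset fun _ => Finset.range (s * Q + 1))
  have hbox : box.card = (s * Q + 1) ^ (s * (Fintype.card ι + Fintype.card κ)) := by
    simp only [box, Finset.card_product, Fintype.card_piFinset, Finset.card_range,
      Finset.prod_const, Finset.card_univ, Fintype.card_prod, Fintype.card_fin]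
    rw [← pow_add, mul_add]
  rw [← hbox, Set.ncard_eq_toFinset_card']
  refine Finset.card_le_mul_card_image_of_maps_to (f := fun f => (rowM f, colM f)) ?_ _ ?_
  · intro f _
    simp only [box, Finset.mem_product, Fintype.mem_piFinset, Finset.mem_range, Nat.lt_succ_iff]
    constructor
    · intro a
      refine (Finset.sum_le_card_nsmul _ _ Q fun b _ => hf1 _ _).trans ?_
      simp
    · intro b
      refine (Finset.sum_le_card_nsmul _ _ Q fun a _ => hf2 _ _).trans ?_
      simp
  · rintro ⟨R', C'⟩ _
    rcases Finset.eq_empty_or_nonempty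
      (Finset.filter (fun f => (rowM f, colM f) = (R', C'))
        {f : Fin s × Fin s → ∀ i j, Fin (K i j + 1) |
          ∀ i, ∑ x, marginDefect K R C (f x) i = 0}.toFinset) with h | ⟨f₀, hf₀⟩
    · rw [h]; simp
    simp only [Finset.mem_filter, Set.mem_toFinset, Set.mem_ofPred_eq, Prod.mk.injEq] at hf₀
    obtain ⟨hz, rfl, rfl⟩ := hf₀
    refine le_trans ?_ (tableCount_blockClone_le_uniform s K R C (rowM f₀) (colM f₀) ?_ ?_)
    · rw [← Set.ncard_coe_finset]
      refine Set.ncard_le_ncard_of_injOn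
        (fun f (a : Fin s × ι) (b : Fin s × κ) => (f (a.1, b.1) a.2 b.2 : ℕ)) ?_ ?_
        (boundedTables_finite _ _ _)
      · intro f hf
        simp only [Finset.coe_filter, Set.mem_toFinset, Set.mem_ofPred_eq, Prod.mk.injEq] at hf
        obtain ⟨-, h1, h2⟩ := hf
        refine ⟨fun a => ?_, fun b => ?_, fun a b => Nat.lt_succ_iff.1 (Fin.is_lt _)⟩
        · rw [← h1, Fintype.sum_prod_type]
        · rw [← h2, Fintype.sum_prod_type]
      · intro f _ g _ hfg
        funext x i j
        exact Fin.ext (congrFun (congrFun hfg (x.1, i)) (x.2, j))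
    · intro i
      have := hz (.inl i)
      simp only [marginDefect, Sum.elim_inl, Finset.sum_sub_distrib, Finset.sum_const,
        Finset.card_univ, Fintype.card_prod, Fintype.card_fin, nsmul_eq_mul,
        Fintype.sum_prod_type] at this
      simp only [rowM]
      zify
      push_cast at this
      linarith
    · intro j
      have := hz (.inr j)
      simp only [marginDefect, Sum.elim_inr, Finset.sum_sub_distrib, Finset.sum_const,
        Finset.card_univ, Fintype.card_prod, Fintype.card_fin, nsmul_eq_mul,
        Fintype.sum_prod_type] at this
      simp only [colM]
      rw [Finset.sum_comm]
      zify
      push_cast at this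
      linarith

lemma exists_log_tableCount_blockClone_ge {ι κ : Type*} [Fintype ι] [Fintype κ]
    (K : Matrix ι κ ℕ) (R : ι → ℕ) (C : κ → ℕ) (hT : 0 < tableCount K R C)
    (hpos : 0 < genFunInf K R C) :
    ∃ c : ℝ, 0 ≤ c ∧ ∀ s : ℕ, 2 ≤ s →
      s ^ 2 * Real.log (genFunInf K R C) - c * (s * Real.log s) ≤
      Real.log (tableCount (blockClone s K) (fun a => s * R a.2) (fun b => s * C b.2)) := by
  classical
  have hT' := hT
  rw [tableCount_eq_ncard_pi] at hT'
  obtain ⟨A₀, hA1, hA2⟩ := (Set.ncard_pos (Set.toFinite _)).1 hT'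
  obtain ⟨c, hc, h⟩ := log_ncard_sum_eq_zero_ge (marginDefect K R C) A₀
    (by funext i; rcases i with i | j <;> simp [marginDefect, hA1, hA2, -Nat.cast_sum])
    _ (log_genFunInf_le K R C hpos)
  set Q := ∑ i, ∑ j, K i j with hQ
  set D : ℕ := Fintype.card ι + Fintype.card κ with hD
  have hlQ : 0 ≤ Real.log ((Q : ℝ) + 1) :=
    Real.log_nonneg (by linarith [Q.cast_nonneg (α := ℝ)])
  -- Since `log s ≥ 1/2` for `s ≥ 2`, one has `1 + log (s² + 1) ≤ 5 log s` for the word count and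
  -- `log (sQ + 1) ≤ (1 + 2 log (Q + 1)) log s` for the number of margins.
  refine ⟨5 * c + D * (1 + 2 * Real.log (Q + 1)), by positivity, fun s hs => ?_⟩
  have : NeZero s := ⟨by omega⟩
  have h1 := h (Fin s × Fin s)
  have hsR : (2 : ℝ) ≤ s := by exact_mod_cast hs
  have hls : 1 / 2 ≤ Real.log s := by
    have := Real.log_le_log two_pos hsR
    have := Real.log_two_gt_d9
    linarith
  have h2 : Real.log ({f : Fin s × Fin s → ∀ i j, Fin (K i j + 1) |
      ∀ i, ∑ x, marginDefect K R C (f x) i = 0}.ncard : ℝ) ≤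
      Real.log (tableCount (blockClone s K) (fun a => s * R a.2) (fun b => s * C b.2)) +
        s * D * Real.log (s * Q + 1) := by
    have hn : 0 < {f : Fin s × Fin s → ∀ i j, Fin (K i j + 1) |
        ∀ i, ∑ x, marginDefect K R C (f x) i = 0}.ncard := by
      refine (Set.ncard_pos (Set.toFinite _)).2 ⟨fun _ => A₀, fun i => ?_⟩
      rcases i with i | j <;> simp [marginDefect, hA1, hA2, -Nat.cast_sum]
    have h3 := Real.log_le_log (Nat.cast_pos.2 hn) (Nat.cast_le (α := ℝ).2 (ncard_words_le s K R C))
    have hTs := tableCount_blockClone_pos s K R C hT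
    push_cast at h3
    rw [Real.log_mul (by positivity) (by positivity), Real.log_pow] at h3
    rw [hQ, hD]
    push_cast at h3 ⊢
    exact h3
  have h4 : Real.log ((s : ℝ) * Q + 1) ≤ Real.log s * (1 + 2 * Real.log (Q + 1)) := by
    have : Real.log ((s : ℝ) * Q + 1) ≤ Real.log (s * (Q + 1)) :=
      Real.log_le_log (by positivity) (by linarith)
    rw [Real.log_mul (by positivity) (by positivity)] at this
    nlinarith
  have h5 : 1 + Real.log ((s : ℝ) * s + 1) ≤ 5 * Real.log s := by
    have : Real.log ((s : ℝ) * s + 1) ≤ Real.log ((s : ℝ) ^ 3) :=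
      Real.log_le_log (by positivity) (by nlinarith)
    rw [Real.log_pow] at this
    push_cast at this
    linarith
  simp only [Fintype.card_prod, Fintype.card_fin, Nat.cast_mul] at h1
  have h6 : c * (1 + Real.log ((s : ℝ) * s + 1)) ≤ 5 * c * (s * Real.log s) := by
    have : 5 * Real.log s ≤ 5 * (s * Real.log s) := by nlinarith
    nlinarith
  have h7 : (s : ℝ) * D * Real.log (s * Q + 1) ≤
      D * (1 + 2 * Real.log (Q + 1)) * (s * Real.log s) := by
    calc (s : ℝ) * D * Real.log (s * Q + 1)
        ≤ s * D * (Real.log s * (1 + 2 * Real.log (Q + 1))) := by gcongr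
      _ = _ := by ring
  nlinarith

theorem theorem2 {m n : ℕ} (R : Fin m → ℕ) (C : Fin n → ℕ) (K : Matrix (Fin m) (Fin n) ℕ)
    (hR : ∀ i, 0 < R i) (hC : ∀ j, 0 < C j) (hK : ∀ i j, 0 < K i j)
    (hT : 0 < tableCount K R C) :
    (∀ s : ℕ, 0 < tableCount (cloneMatrix s K) (cloneMargin s R) (cloneMargin s C)) ∧
    0 < genFunInf K R C ∧
    Tendsto
      (fun s : ℕ => 1 / (s : ℝ) ^ 2 *
        Real.log (tableCount (cloneMatrix s K) (cloneMargin s R) (cloneMargin s C)))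
      atTop (𝓝 (Real.log (genFunInf K R C))) ∧
    (fun s : ℕ => 1 / (s : ℝ) ^ 2 *
        Real.log (tableCount (cloneMatrix s K) (cloneMargin s R) (cloneMargin s C))
        - Real.log (genFunInf K R C))
      =O[atTop] (fun s : ℕ => Real.log s / s) := by
  have hpos : 0 < genFunInf K R C :=
    lt_of_lt_of_le (Nat.cast_pos.2 hT)
      (le_genFunInf K R C fun x y hx hy => tableCount_le_genFun_div K R C hx hy)
  simp only [tableCount_clone]
  have hO : (fun s : ℕ => 1 / (s : ℝ) ^ 2 *
        Real.log (tableCount (blockClone s K) (fun a => s * R a.2) (fun b => s * C b.2))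
        - Real.log (genFunInf K R C)) =O[atTop] (fun s : ℕ => Real.log s / s) := by
    obtain ⟨c, hc, hlow⟩ := exists_log_tableCount_blockClone_ge K R C hT hpos
    refine IsBigO.of_bound c ?_
    filter_upwards [eventually_ge_atTop 2] with s hs
    have hup := log_tableCount_blockClone_le (show 0 < s by omega) K R C hT
    have hlo := hlow s hs
    have hsR : (0 : ℝ) < s := by exact_mod_cast (by omega : 0 < s)
    have hls : 0 ≤ Real.log s := Real.log_natCast_nonneg s
    rw [Real.norm_eq_abs, Real.norm_of_nonneg (by positivity)]
    set T := Real.log (tableCount (blockClone s K) (fun a => s * R a.2) (fun b => s * C b.2))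
    have e1 : 1 / (s : ℝ) ^ 2 * T - Real.log (genFunInf K R C)
        = (T - s ^ 2 * Real.log (genFunInf K R C)) / s ^ 2 := by field_simp
    have e2 : c * (Real.log s / s) = c * (s * Real.log s) / s ^ 2 := by field_simp
    rw [e1, e2, abs_div, abs_of_pos (show (0 : ℝ) < (s : ℝ) ^ 2 by positivity)]
    gcongr
    rw [abs_le]
    have : 0 ≤ c * (s * Real.log s) := by positivity
    constructor <;> linarith
  refine ⟨fun s => tableCount_blockClone_pos s K R C hT, hpos, ?_, hO⟩
  have h0 : Tendsto (fun s : ℕ => Real.log s / s) atTop (𝓝 0) :=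
    (Real.isLittleO_log_id_atTop.tendsto_div_nhds_zero).comp tendsto_natCast_atTop_atTop
  exact tendsto_sub_nhds_zero_iff.1 (hO.trans_tendsto h0)
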